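/- Let $\mu_0$ and $\mu_1$ be compactly supported Borel probability measures on $\mathbb R^{d_0}$ and $\mathbb R^{d_1}$, and let $\Pi(\mu_0,\mu_1)$ be the set of their couplings. For $A\in\mathbb R^{d_0\times d_1}$ and $\varepsilon\ge 0$, let $\mathsf{OT}_{A,\varepsilon}$ denote the problem $$\mathsf{OT}_{A,\varepsilon}(\mu_0,\mu_1)=\inf_{\pi\in\Pi(\mu_0,\mu_1)}\Big\{\int c_A\,d\pi+\varepsilon\,\mathsf D_{\mathsf{KL}}(\pi\|\mu_0\otimes\mu_1)\Big\},\qquad c_A(x,y)=-4\|x\|^2\|y\|^2-32\,x^{\intercal}Ay,$$ where for $\varepsilon=0$ the second term is absent (unregularized optimal transport). Let $\|\cdot\|_F$ be the Frobenius norm and put $\Phi_\varepsilon(A)=32\|A\|_F^2+\mathsf{OT}_{A,\varepsilon}(\mu_0,\mu_1)$. For $M\in\mathbb R$ let $\mathcal D_M=\{A\in\mathbb R^{d_0\times d_1}:\|A\|_F\le M/2\}$. For $\varepsilon>0$, the Fréchet derivative $D(\Phi_\varepsilon)_{[A]}$ is identified with the matrix in $\mathbb R^{d_0\times d_1}$ that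 represents it through the Frobenius inner product. Fix $M$ and $\delta\ge 0$. For every $\varepsilon>0$ let $A^\star_\varepsilon\in\mathcal D_M$ satisfy $\|D(\Phi_\varepsilon)_{[A^\star_\varepsilon]}\|_F\le\delta$, and let $A^\star_0$ be a cluster point of $(A^\star_\varepsilon)_{\varepsilon>0}$ as $\varepsilon\downarrow 0$. Then: 1. there is a solution (optimal coupling) $\pi$ of the unregularized problem $\mathsf{OT}_{A^\star_0,0}(\mu_0,\mu_1)$ with $\big\|64A^\star_0-32\int xy^{\intercal}\,d\pi(x,y)\big\|_F\le\delta$; 2. if $A^\star_\varepsilon$ is a global minimizer of $\Phi_\varepsilon$ on $\mathbb R^{d_0\times d_1}$ for all sufficiently small $\varepsilon>0$, then $A^\star_0$ is a global minimizer of $\Phi_0$; 3. if there are $r>0$ and a sequence $\varepsilon_n>0$ with $\varepsilon_n\to 0$ and $A^\star_{\varepsilon_n}\to A^\star_0$ such that, for every $n$, $\Phi_{\varepsilon_n}(A^\star_{\varepsilon_n})\le\Phi_{\varepsilon_n}(B)$ for all $B$ in the open ball of radius $r$ centred at $A^\star_0$ (in particular, if $A^\star_{\varepsilon_n}$ minimizes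 $\Phi_{\varepsilon_n}$ on the closed ball), then $A^\star_0$ is a local minimizer of $\Phi_0$. -/

import Mathlib

open MeasureTheory Filter Topology
open scoped Matrix

/-! Throughout, matrices carry the Frobenius norm `‖A‖ = (∑ i j, A i j ^ 2) ^ (1 / 2)`. -/

attribute [local instance] Matrix.frobeniusNormedAddCommGroup Matrix.frobeniusNormedSpace

namespace EntropicGW

noncomputable section

/-- `Π(μ₀, μ₁)`: the Borel measures on the product with marginals `μ₀` and `μ₁`. -/
def couplings {d₀ d₁ : ℕ} (μ₀ : Measure (EuclideanSpace ℝ (Fin d₀)))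
    (μ₁ : Measure (EuclideanSpace ℝ (Fin d₁))) :
    Set (Measure (EuclideanSpace ℝ (Fin d₀) × EuclideanSpace ℝ (Fin d₁))) :=
  {π | π.fst = μ₀ ∧ π.snd = μ₁}

/-- The cost `c_A(x, y) = -4 ‖x‖² ‖y‖² - 32 xᵀ A y`. -/
def cost {d₀ d₁ : ℕ} (A : Matrix (Fin d₀) (Fin d₁) ℝ)
    (p : EuclideanSpace ℝ (Fin d₀) × EuclideanSpace ℝ (Fin d₁)) : ℝ :=
  -4 * ‖p.1‖ ^ 2 * ‖p.2‖ ^ 2 - 32 * (p.1.ofLp ⬝ᵥ A *ᵥ p.2.ofLp)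

/-- The functional `π ↦ ∫ c_A dπ + ε KL(π ‖ μ₀ ⊗ μ₁)` with values in `(-∞, ∞]`. The product
`ε * KL` is taken in `[0, ∞]`, where `0 * ∞ = 0`, so that `ε = 0` gives the transport cost
`∫ c_A dπ` of every coupling. The cost is continuous, hence integrable against couplings of
compactly supported marginals. -/
def eotObjective {d₀ d₁ : ℕ} (μ₀ : Measure (EuclideanSpace ℝ (Fin d₀)))
    (μ₁ : Measure (EuclideanSpace ℝ (Fin d₁))) (A : Matrix (Fin d₀) (Fin d₁) ℝ) (ε : ℝ)
    (π : Measure (EuclideanSpace ℝ (Fin d₀) × EuclideanSpace ℝ (Fin d₁))) : EReal :=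
  ((∫ p, cost A p ∂π : ℝ) : EReal) +
    ((ENNReal.ofReal ε * InformationTheory.klDiv π (μ₀.prod μ₁) : ENNReal) : EReal)

/-- The optimal value `OT_{A,ε}(μ₀, μ₁)`, for `ε ≥ 0`; the case `ε = 0` is classical (unregularized)
optimal transport. For compactly supported probability measures the infimum is finite. -/
def otValue {d₀ d₁ : ℕ} (μ₀ : Measure (EuclideanSpace ℝ (Fin d₀)))
    (μ₁ : Measure (EuclideanSpace ℝ (Fin d₁))) (A : Matrix (Fin d₀) (Fin d₁) ℝ) (ε : ℝ) : ℝ :=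
  (⨅ π ∈ couplings μ₀ μ₁, eotObjective μ₀ μ₁ A ε π).toReal

/-- `π` is a solution of `OT_{A,ε}(μ₀, μ₁)`: a coupling which attains the infimum. -/
def IsOTSolution {d₀ d₁ : ℕ} (μ₀ : Measure (EuclideanSpace ℝ (Fin d₀)))
    (μ₁ : Measure (EuclideanSpace ℝ (Fin d₁))) (A : Matrix (Fin d₀) (Fin d₁) ℝ) (ε : ℝ)
    (π : Measure (EuclideanSpace ℝ (Fin d₀) × EuclideanSpace ℝ (Fin d₁))) : Prop :=
  π ∈ couplings μ₀ μ₁ ∧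
    ∀ π' ∈ couplings μ₀ μ₁, eotObjective μ₀ μ₁ A ε π ≤ eotObjective μ₀ μ₁ A ε π'

/-- `Φ_ε(A) = 32 ‖A‖² + OT_{A,ε}(μ₀, μ₁)`, for `ε ≥ 0`. -/
def Phi {d₀ d₁ : ℕ} (μ₀ : Measure (EuclideanSpace ℝ (Fin d₀)))
    (μ₁ : Measure (EuclideanSpace ℝ (Fin d₁))) (ε : ℝ) (A : Matrix (Fin d₀) (Fin d₁) ℝ) : ℝ :=
  32 * ‖A‖ ^ 2 + otValue μ₀ μ₁ A ε

/-- The set `D_M = {A : ‖A‖ ≤ M / 2}`. -/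
def matrixBall (d₀ d₁ : ℕ) (M : ℝ) : Set (Matrix (Fin d₀) (Fin d₁) ℝ) :=
  {A | ‖A‖ ≤ M / 2}

/-- The matrix that represents the Fréchet derivative of `f` at `A` through the Frobenius inner
product: its `(i, j)` entry is the derivative in the direction of the matrix unit `E_{ij}`. -/
def gradMatrix {d₀ d₁ : ℕ} (f : Matrix (Fin d₀) (Fin d₁) ℝ → ℝ)
    (A : Matrix (Fin d₀) (Fin d₁) ℝ) : Matrix (Fin d₀) (Fin d₁) ℝ :=
  Matrix.of fun i j => fderiv ℝ f A (Matrix.single i j 1)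

/-- The cross-correlation matrix `∫ x yᵀ dπ(x, y)`. -/
def crossCorrelation {d₀ d₁ : ℕ}
    (π : Measure (EuclideanSpace ℝ (Fin d₀) × EuclideanSpace ℝ (Fin d₁))) :
    Matrix (Fin d₀) (Fin d₁) ℝ :=
  Matrix.of fun i j => ∫ p, p.1 i * p.2 j ∂π

end

end EntropicGW

/-! For a fixed coupling the regularized transport cost is affine in `A`, with slope `corrFunctional
π`, that is, -32 times the cross-correlation. Hence `OT_{A,ε}` is an infimum of affine functions of
`A`. Compactness of the supports bounds all slopes by one constant, so `OT_{A,ε}` is Lipschitz in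
`A` uniformly in `ε`.

For `ε > 0` the relative entropy is strictly convex in a quantitative sense: if two couplings are
nearly optimal, comparison with their midpoint forces a small entropy gap, and a Pinsker type
inequality then makes their correlations close. A Danskin argument
(`exists_hasFDerivAt_iInf_affine`) gives differentiability, and the gradient of `Φ_ε` at `A` is a
limit of `64 A - 32 ∫ x yᵀ dπ` over near-optimal `π`. No optimal entropic coupling is needed.

As `ε ↓ 0`, near-optimal couplings converge weakly along an ultrafilter
(`exists_tendsto_couplings`). Costs and correlations are integrals of continuous functions, so they
pass to the limit, which is optimal because `OT_{A,ε} → OT_{A,0}` (`tendsto_otValue`). The lower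
bound there is nonnegativity of the entropy. The upper bound needs couplings of finite entropy to be
dense, which is obtained by replacing a coupling on each block of a fine finite grid by a multiple
of the product measure. The statements on minimizers follow from the same convergence and the
Lipschitz bound, by passing to the limit in `Φ_ε(A_ε) ≤ Φ_ε(B)`. -/

namespace EntropicGW

/-! ### Infima of affine functions and Danskin's theorem -/

section Envelope

variable {E ι : Type*} [NormedAddCommGroup E] [NormedSpace ℝ E] {S : Set ι} {J : ι → ℝ}
  {φ : ι → E →L[ℝ] ℝ} {V : E → ℝ} {C : ℝ}

/-- An infimum of affine functions with uniformly bounded slopes is Lipschitz. -/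
theorem iInf_affine_sub_le (hle : ∀ i ∈ S, ∀ B, V B ≤ J i + φ i B)
    (hex : ∀ B, ∀ η > 0, ∃ i ∈ S, J i + φ i B < V B + η) (hC : ∀ i ∈ S, ‖φ i‖ ≤ C) (A B : E) :
    V A - V B ≤ C * ‖A - B‖ := by
  refine le_of_forall_pos_le_add fun η hη => ?_
  obtain ⟨i, hi, h⟩ := hex B η hη
  have h1 := hle i hi A
  have h2 : φ i A - φ i B ≤ C * ‖A - B‖ := by
    rw [← map_sub]
    exact (le_abs_self _).trans (((φ i).le_opNorm _).trans
      (mul_le_mul_of_nonneg_right (hC i hi) (norm_nonneg _)))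
  linarith

/-- Danskin's theorem for an infimum of affine functions which need not be attained: if the slopes
of near-minimizers at `A` cluster, the infimum is Fréchet differentiable at `A` and its derivative
is the limit of these slopes. -/
theorem exists_hasFDerivAt_iInf_affine (hle : ∀ i ∈ S, ∀ B, V B ≤ J i + φ i B)
    (hex : ∀ B, ∀ η > 0, ∃ i ∈ S, J i + φ i B < V B + η) (hC : ∀ i ∈ S, ‖φ i‖ ≤ C) (A : E)
    (hstab : ∀ τ > 0, ∃ η > 0, ∀ i ∈ S, ∀ j ∈ S, J i + φ i A ≤ V A + η → J j + φ j A ≤ V A + η →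
      ‖φ i - φ j‖ ≤ τ) :
    ∃ L : E →L[ℝ] ℝ, HasFDerivAt V L A ∧
      ∀ τ > 0, ∃ i ∈ S, J i + φ i A < V A + τ ∧ ‖φ i - L‖ ≤ τ := by
  have hpos : ∀ n : ℕ, (0 : ℝ) < 1 / ((n : ℝ) + 1) := fun n => Nat.one_div_pos_of_nat
  choose u huS hu using fun n : ℕ => hex A (1 / ((n : ℝ) + 1)) (hpos n)
  have hsmall : ∀ η > 0, ∃ N : ℕ, ∀ n ≥ N, 1 / ((n : ℝ) + 1) < η := fun η hη =>
    eventually_atTop.1 (tendsto_one_div_add_atTop_nhds_zero_nat.eventually_lt_const hη)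
  have hcau : CauchySeq fun n : ℕ => φ (u n) := by
    refine Metric.cauchySeq_iff.2 fun τ hτ => ?_
    obtain ⟨η, hη, h⟩ := hstab (τ / 2) (by positivity)
    obtain ⟨N, hN⟩ := hsmall η hη
    refine ⟨N, fun m hm n hn => ?_⟩
    rw [dist_eq_norm]
    have := h (u m) (huS m) (u n) (huS n) (by linarith [hu m, hN m hm]) (by linarith [hu n, hN n hn])
    linarith
  obtain ⟨L, hL⟩ := cauchySeq_tendsto_of_complete hcau
  -- `L` is the limit of one minimizing sequence of slopes; by `hstab` it is also close to the slope
  -- of every near-minimizer at `A`.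
  have hLnear : ∀ τ > 0, ∃ η > 0, ∀ i ∈ S, J i + φ i A ≤ V A + η → ‖φ i - L‖ ≤ τ := by
    intro τ hτ
    obtain ⟨η, hη, h⟩ := hstab τ hτ
    refine ⟨η, hη, fun i hi hiA => ?_⟩
    refine le_of_tendsto (tendsto_const_nhds.sub hL).norm ?_
    obtain ⟨N, hN⟩ := hsmall η hη
    filter_upwards [eventually_ge_atTop N] with n hn
    exact h i hi (u n) (huS n) hiA (by linarith [hu n, hN n hn])
  refine ⟨L, ?_, fun τ hτ => ?_⟩
  swap
  · obtain ⟨η, hη, h⟩ := hLnear τ hτ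
    obtain ⟨i, hi, hiA⟩ := hex A (min η τ) (lt_min hη hτ)
    exact ⟨i, hi, by linarith [min_le_right η τ], h i hi (by linarith [min_le_left η τ])⟩
  rw [hasFDerivAt_iff_isLittleO_nhds_zero, Asymptotics.isLittleO_iff]
  intro τ hτ
  obtain ⟨η, hη, hnear⟩ := hLnear τ hτ
  have hC0 : 0 ≤ C := (norm_nonneg _).trans (hC _ (huS 0))
  -- For such `H`, the infimum and each affine function together move by at most `2 C ‖H‖ ≤ η / 2`,
  -- so an `η / 2`-minimizer at `A + H` is still an `η`-minimizer at `A`.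
  have hball : ∀ᶠ H : E in 𝓝 0, ‖H‖ < η / (4 * (C + 1)) := by
    have : Tendsto (fun H : E => ‖H‖) (𝓝 0) (𝓝 0) := by simpa using (continuous_norm (E := E)).tendsto 0
    exact this.eventually_lt_const (by positivity)
  filter_upwards [hball] with H hH
  have hCH : 2 * (C * ‖H‖) ≤ η / 2 := by
    rw [lt_div_iff₀ (by positivity)] at hH
    nlinarith [norm_nonneg H]
  -- Near-minimizers at the base point `A` serve as competitors at `A + H`.
  have hupper : V (A + H) - V A - L H ≤ 0 := by
    have hlim : Tendsto (fun n : ℕ => V A + 1 / ((n : ℝ) + 1) + φ (u n) H) atTop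
        (𝓝 (V A + (0 : ℝ) + L H)) :=
      (tendsto_const_nhds.add tendsto_one_div_add_atTop_nhds_zero_nat).add
        (((ContinuousLinearMap.apply ℝ ℝ H).continuous.tendsto L).comp hL)
    have := ge_of_tendsto' hlim (b := V (A + H)) fun n => by
      have h1 := hle (u n) (huS n) (A + H)
      rw [map_add] at h1
      linarith [hu n]
    linarith
  -- The roles are exchanged: a near-minimizer at `A + H` competes at `A`, and `hnear` controls its
  -- slope.
  have hlower : -(τ * ‖H‖) ≤ V (A + H) - V A - L H := by
    refine le_of_forall_pos_le_add fun ξ hξ => ?_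
    obtain ⟨i, hi, hiH⟩ := hex (A + H) (min ξ (η / 2)) (lt_min hξ (by positivity))
    have h1 := hle i hi A
    rw [map_add] at hiH
    have hL1 := iInf_affine_sub_le hle hex hC (A + H) A
    rw [add_sub_cancel_left] at hL1
    have h2 : |φ i H| ≤ C * ‖H‖ := by
      rw [← Real.norm_eq_abs]
      exact ((φ i).le_opNorm _).trans (mul_le_mul_of_nonneg_right (hC i hi) (norm_nonneg _))
    have h3 := hnear i hi (by linarith [min_le_right ξ (η / 2), neg_abs_le (φ i H)])
    have h4 : |φ i H - L H| ≤ τ * ‖H‖ := by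
      rw [← Real.norm_eq_abs, ← sub_apply]
      exact ((φ i - L).le_opNorm _).trans (mul_le_mul_of_nonneg_right h3 (norm_nonneg _))
    linarith [min_le_left ξ (η / 2), neg_abs_le (φ i H - L H)]
  rw [Real.norm_eq_abs, abs_le]
  exact ⟨hlower, hupper.trans (by positivity)⟩

end Envelope

/-! ### Quantitative strict convexity of relative entropy -/

section Entropy

open InformationTheory

/-- The integrand of the Kullback-Leibler divergence dominates that of the Hellinger distance. -/
theorem sq_sqrt_sub_one_le_klFun {x : ℝ} (hx : 0 ≤ x) : (√x - 1) ^ 2 ≤ klFun x := by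
  rcases hx.eq_or_lt with rfl | hx
  · simp [klFun_zero]
  have hs : 0 < √x := Real.sqrt_pos.2 hx
  have h1 : 1 - (√x)⁻¹ ≤ Real.log √x := Real.one_sub_inv_le_log_of_pos hs
  have h2 : Real.log x = 2 * Real.log √x := by rw [Real.log_sqrt hx.le]; ring
  have h3 : x * (√x)⁻¹ = √x := by
    nth_rw 1 [← Real.mul_self_sqrt hx.le]
    field_simp
  have h4 := mul_le_mul_of_nonneg_left h1 hx.le
  rw [klFun_apply, h2, sub_sq, Real.sq_sqrt hx.le]
  rw [mul_sub, h3] at h4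
  linarith

/-- The perspective of the preceding bound: take `x = a / s` and multiply by `s`. -/
theorem sq_sqrt_sub_sqrt_le {a s : ℝ} (ha : 0 ≤ a) (hs : 0 < s) :
    (√a - √s) ^ 2 ≤ a * Real.log a - a * Real.log s + s - a := by
  rcases ha.eq_or_lt with rfl | ha
  · simp [Real.sq_sqrt hs.le]
  have h := mul_le_mul_of_nonneg_left (sq_sqrt_sub_one_le_klFun (div_nonneg ha.le hs.le)) hs.le
  have hss : 0 < √s := Real.sqrt_pos.2 hs
  have e1 : s * (√(a / s) - 1) ^ 2 = (√a - √s) ^ 2 := by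
    rw [Real.sqrt_div ha.le]
    nth_rw 1 [← Real.sq_sqrt hs.le]
    field_simp
  have e2 : s * klFun (a / s) = a * Real.log a - a * Real.log s + s - a := by
    rw [klFun_apply, Real.log_div ha.ne' hs.ne']
    field_simp
  rwa [e1, e2] at h

/-- Quantitative strict convexity of `klFun`. -/
theorem abs_sub_le_klFun_gap {a b l : ℝ} (ha : 0 ≤ a) (hb : 0 ≤ b) (hl : 0 < l) :
    |a - b| ≤ l * (klFun a + klFun b - 2 * klFun ((a + b) / 2)) + (a + b) / l := by
  rcases (add_nonneg ha hb).eq_or_lt with h0 | h0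
  · have ha0 : a = 0 := by linarith
    have hb0 : b = 0 := by linarith
    subst ha0 hb0
    norm_num [klFun_zero]
  have hs : 0 < (a + b) / 2 := by positivity
  have h1 := sq_sqrt_sub_sqrt_le ha hs
  have h2 := sq_sqrt_sub_sqrt_le hb hs
  -- Add `h1` and `h2` at the midpoint `s`: the right sides sum to the convexity gap. On the left,
  -- the parallelogram identity leaves half of `(√a - √b) ^ 2` plus half of the square supplied
  -- here.
  have hgap : (√a - √b) ^ 2 / 2 ≤ klFun a + klFun b - 2 * klFun ((a + b) / 2) := by
    simp only [klFun_apply]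
    nlinarith [sq_nonneg (√a + √b - 2 * √((a + b) / 2))]
  have hab : |a - b| = |√a - √b| * (√a + √b) := by
    nth_rw 1 [← Real.mul_self_sqrt ha, ← Real.mul_self_sqrt hb]
    rw [mul_self_sub_mul_self, abs_mul, abs_of_nonneg (by positivity : 0 ≤ √a + √b), mul_comm]
  have hsum : (√a + √b) ^ 2 ≤ 2 * (a + b) := by
    nlinarith [sq_nonneg (√a - √b), Real.sq_sqrt ha, Real.sq_sqrt hb]
  -- Young's inequality; the free weight `l` later balances the gap against the total mass.
  have hyoung : |√a - √b| * (√a + √b) ≤ l * ((√a - √b) ^ 2 / 2) + (√a + √b) ^ 2 / (2 * l) := by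
    rw [← sq_abs (√a - √b), ← sub_nonneg]
    have e : l * (|√a - √b| ^ 2 / 2) + (√a + √b) ^ 2 / (2 * l) - |√a - √b| * (√a + √b)
        = (l * |√a - √b| - (√a + √b)) ^ 2 / (2 * l) := by
      field_simp
      ring
    rw [e]
    positivity
  calc |a - b| ≤ l * ((√a - √b) ^ 2 / 2) + (√a + √b) ^ 2 / (2 * l) := hab ▸ hyoung
    _ ≤ l * (klFun a + klFun b - 2 * klFun ((a + b) / 2)) + 2 * (a + b) / (2 * l) := by gcongr
    _ = _ := by congr 1; field_simp

variable {α : Type*} {mα : MeasurableSpace α}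

/-- The midpoint of two measures. -/
noncomputable def midMeasure (μ ν : Measure α) : Measure α := (2⁻¹ : NNReal) • (μ + ν)

theorem integral_midMeasure {μ ν : Measure α} {f : α → ℝ} (hμ : Integrable f μ)
    (hν : Integrable f ν) : ∫ x, f x ∂midMeasure μ ν = (∫ x, f x ∂μ + ∫ x, f x ∂ν) / 2 := by
  rw [midMeasure, integral_smul_nnreal_measure, integral_add_measure hμ hν, NNReal.smul_def,
    smul_eq_mul]
  push_cast
  ring

variable {μ ν ρ : Measure α} [IsFiniteMeasure μ] [IsFiniteMeasure ν] [IsFiniteMeasure ρ]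

instance : IsFiniteMeasure (midMeasure μ ν) := by unfold midMeasure; infer_instance

theorem rnDeriv_midMeasure : ∀ᵐ x ∂ρ, ((midMeasure μ ν).rnDeriv ρ x).toReal =
    ((μ.rnDeriv ρ x).toReal + (ν.rnDeriv ρ x).toReal) / 2 := by
  filter_upwards [Measure.rnDeriv_smul_left (μ + ν) ρ 2⁻¹, Measure.rnDeriv_add μ ν ρ,
    Measure.rnDeriv_ne_top μ ρ, Measure.rnDeriv_ne_top ν ρ] with x h1 h2 h3 h4
  rw [midMeasure, h1, Pi.smul_apply, h2, Pi.add_apply, ENNReal.smul_def, smul_eq_mul,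
    ENNReal.toReal_mul, ENNReal.toReal_add h3 h4]
  simp
  ring

theorem integrable_klFun_of_klDiv_ne_top (h : klDiv μ ρ ≠ ⊤) :
    Integrable (fun x => klFun (μ.rnDeriv ρ x).toReal) ρ :=
  (integrable_klFun_rnDeriv_iff (klDiv_ne_top_iff.1 h).1).2 (klDiv_ne_top_iff.1 h).2

/-- By convexity, `klFun` of the averaged density is at most the average of the two integrable
functions, and `klFun` is nonnegative. -/
theorem klDiv_midMeasure_ne_top (hμ : klDiv μ ρ ≠ ⊤) (hν : klDiv ν ρ ≠ ⊤) :
    klDiv (midMeasure μ ν) ρ ≠ ⊤ := by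
  have hac : midMeasure μ ν ≪ ρ :=
    ((klDiv_ne_top_iff.1 hμ).1.add_left (klDiv_ne_top_iff.1 hν).1).smul_left _
  refine klDiv_ne_top hac ((integrable_klFun_rnDeriv_iff hac).1 ?_)
  refine ((integrable_klFun_of_klDiv_ne_top hμ).add (integrable_klFun_of_klDiv_ne_top hν)).mono'
    (Measurable.aestronglyMeasurable (by fun_prop)) ?_
  filter_upwards [rnDeriv_midMeasure (μ := μ) (ν := ν) (ρ := ρ)] with x hx
  have ha : 0 ≤ (μ.rnDeriv ρ x).toReal := ENNReal.toReal_nonneg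
  have hb : 0 ≤ (ν.rnDeriv ρ x).toReal := ENNReal.toReal_nonneg
  rw [hx, Real.norm_eq_abs, abs_of_nonneg (klFun_nonneg (by positivity)), Pi.add_apply]
  have h := convexOn_klFun.2 ha hb (by norm_num : (0 : ℝ) ≤ 1 / 2) (by norm_num : (0 : ℝ) ≤ 1 / 2)
    (by norm_num)
  simp only [smul_eq_mul] at h
  rw [show ((μ.rnDeriv ρ x).toReal + (ν.rnDeriv ρ x).toReal) / 2 =
    1 / 2 * (μ.rnDeriv ρ x).toReal + 1 / 2 * (ν.rnDeriv ρ x).toReal by ring]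
  linarith [klFun_nonneg ha, klFun_nonneg hb]

/-- A Pinsker type inequality: integrals of a bounded function against two measures are close when
the midpoint convexity gap of the Kullback-Leibler divergence is small. -/
theorem abs_integral_sub_le_klDiv_gap (hμ : klDiv μ ρ ≠ ⊤) (hν : klDiv ν ρ ≠ ⊤) {g : α → ℝ} {C : ℝ}
    (hg : AEStronglyMeasurable g ρ) (hC : ∀ᵐ x ∂ρ, |g x| ≤ C) (hC0 : 0 ≤ C) {l : ℝ} (hl : 0 < l) :
    |∫ x, g x ∂μ - ∫ x, g x ∂ν| ≤ C * (l * ((klDiv μ ρ).toReal + (klDiv ν ρ).toReal -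
      2 * (klDiv (midMeasure μ ν) ρ).toReal) + (μ.real Set.univ + ν.real Set.univ) / l) := by
  have hμac := (klDiv_ne_top_iff.1 hμ).1
  have hνac := (klDiv_ne_top_iff.1 hν).1
  have hm := klDiv_midMeasure_ne_top hμ hν
  rw [toReal_klDiv_eq_integral_klFun hμac, toReal_klDiv_eq_integral_klFun hνac,
    toReal_klDiv_eq_integral_klFun (klDiv_ne_top_iff.1 hm).1]
  have iμ : Integrable (fun x => (μ.rnDeriv ρ x).toReal) ρ := Measure.integrable_toReal_rnDeriv
  have iν : Integrable (fun x => (ν.rnDeriv ρ x).toReal) ρ := Measure.integrable_toReal_rnDeriv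
  have kμ := integrable_klFun_of_klDiv_ne_top hμ
  have kν := integrable_klFun_of_klDiv_ne_top hν
  have km := integrable_klFun_of_klDiv_ne_top hm
  have gμ : Integrable (fun x => (μ.rnDeriv ρ x).toReal * g x) ρ :=
    iμ.mul_bdd hg hC
  have gν : Integrable (fun x => (ν.rnDeriv ρ x).toReal * g x) ρ :=
    iν.mul_bdd hg hC
  rw [← integral_rnDeriv_smul hμac (f := g), ← integral_rnDeriv_smul hνac (f := g)]
  simp only [smul_eq_mul]
  rw [← integral_sub gμ gν, ← Measure.integral_toReal_rnDeriv hμac,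
    ← Measure.integral_toReal_rnDeriv hνac]
  have iμν : Integrable (fun x => (μ.rnDeriv ρ x).toReal + (ν.rnDeriv ρ x).toReal) ρ := iμ.add iν
  have kμν : Integrable (fun x => klFun (μ.rnDeriv ρ x).toReal + klFun (ν.rnDeriv ρ x).toReal) ρ :=
    kμ.add kν
  have kgap : Integrable (fun x => klFun (μ.rnDeriv ρ x).toReal + klFun (ν.rnDeriv ρ x).toReal -
      2 * klFun ((midMeasure μ ν).rnDeriv ρ x).toReal) ρ := kμν.sub (km.const_mul 2)
  rw [← integral_add iμ iν, ← integral_add kμ kν, ← integral_const_mul 2,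
    ← integral_sub kμν (km.const_mul 2), ← integral_const_mul l, ← integral_div,
    ← integral_add (kgap.const_mul l) (iμν.div_const l), ← integral_const_mul C]
  refine (abs_integral_le_integral_abs).trans (integral_mono_ae (gμ.sub gν).abs
    (((kgap.const_mul l).add (iμν.div_const l)).const_mul C) ?_)
  filter_upwards [rnDeriv_midMeasure (μ := μ) (ν := ν) (ρ := ρ), hC] with x hx hCx
  rw [hx, ← sub_mul, abs_mul, mul_comm]
  exact mul_le_mul hCx (abs_sub_le_klFun_gap ENNReal.toReal_nonneg ENNReal.toReal_nonneg hl)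
    (abs_nonneg _) hC0

end Entropy

/-- The continuous dual for the topology of the norm: matrices carry several topology instances. -/
abbrev NormedDual (E : Type*) [NormedAddCommGroup E] [NormedSpace ℝ E] : Type _ := E →L[ℝ] ℝ

/-! ### Transport cost as a function of the matrix; differentiability for positive regularization -/

section Couplings

open InformationTheory

variable {d₀ d₁ : ℕ} {μ₀ : Measure (EuclideanSpace ℝ (Fin d₀))}
  {μ₁ : Measure (EuclideanSpace ℝ (Fin d₁))}
  {π : Measure (EuclideanSpace ℝ (Fin d₀) × EuclideanSpace ℝ (Fin d₁))}

theorem isProbabilityMeasure_of_mem_couplings [IsProbabilityMeasure μ₀] (hπ : π ∈ couplings μ₀ μ₁) :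
    IsProbabilityMeasure π :=
  ⟨by rw [← Measure.fst_univ, hπ.1, measure_univ]⟩

theorem prod_mem_couplings [IsProbabilityMeasure μ₀] [IsProbabilityMeasure μ₁] :
    μ₀.prod μ₁ ∈ couplings μ₀ μ₁ :=
  ⟨Measure.fst_prod, Measure.snd_prod⟩

theorem midMeasure_mem_couplings
    {π' : Measure (EuclideanSpace ℝ (Fin d₀) × EuclideanSpace ℝ (Fin d₁))}
    (hπ : π ∈ couplings μ₀ μ₁) (hπ' : π' ∈ couplings μ₀ μ₁) :
    midMeasure π π' ∈ couplings μ₀ μ₁ := by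
  have h : ∀ x : ENNReal, (2⁻¹ : NNReal) • (x + x) = x := fun x => by
    rw [← two_mul, ENNReal.smul_def, smul_eq_mul, ← mul_assoc]
    simp [ENNReal.inv_mul_cancel]
  constructor
  · ext s hs
    rw [Measure.fst_apply hs, midMeasure, Measure.smul_apply, Measure.add_apply,
      ← Measure.fst_apply hs, ← Measure.fst_apply hs, hπ.1, hπ'.1, h]
  · ext s hs
    rw [Measure.snd_apply hs, midMeasure, Measure.smul_apply, Measure.add_apply,
      ← Measure.snd_apply hs, ← Measure.snd_apply hs, hπ.2, hπ'.2, h]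

theorem ae_mem_support_of_mem_couplings (hπ : π ∈ couplings μ₀ μ₁) :
    ∀ᵐ p ∂π, p ∈ μ₀.support ×ˢ μ₁.support := by
  have h0 : ∀ᵐ x ∂π.fst, x ∈ μ₀.support := by rw [hπ.1]; exact Measure.support_mem_ae
  have h1 : ∀ᵐ y ∂π.snd, y ∈ μ₁.support := by rw [hπ.2]; exact Measure.support_mem_ae
  filter_upwards [ae_of_ae_map measurable_fst.aemeasurable h0,
    ae_of_ae_map measurable_snd.aemeasurable h1] with p hp0 hp1 using ⟨hp0, hp1⟩

/-- All couplings are concentrated on the same compact product of supports, so one constant serves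
them all. -/
theorem exists_ae_abs_le (hμ₀ : IsCompact μ₀.support) (hμ₁ : IsCompact μ₁.support)
    {f : EuclideanSpace ℝ (Fin d₀) × EuclideanSpace ℝ (Fin d₁) → ℝ} (hf : Continuous f) :
    ∃ C, 0 ≤ C ∧ ∀ π ∈ couplings μ₀ μ₁, ∀ᵐ p ∂π, |f p| ≤ C := by
  obtain ⟨C, hC⟩ := (hμ₀.prod hμ₁).exists_bound_of_continuousOn hf.continuousOn
  refine ⟨max C 0, le_max_right _ _, fun π hπ => ?_⟩
  filter_upwards [ae_mem_support_of_mem_couplings hπ] with p hp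
  exact (hC p hp).trans (le_max_left _ _)

/-- The part of the regularized transport cost which does not depend on `A`. -/
noncomputable def fixedCost (μ₀ : Measure (EuclideanSpace ℝ (Fin d₀)))
    (μ₁ : Measure (EuclideanSpace ℝ (Fin d₁))) (ε : ℝ)
    (π : Measure (EuclideanSpace ℝ (Fin d₀) × EuclideanSpace ℝ (Fin d₁))) : ℝ :=
  ∫ p, -4 * ‖p.1‖ ^ 2 * ‖p.2‖ ^ 2 ∂π + (ENNReal.ofReal ε * klDiv π (μ₀.prod μ₁)).toReal

/-- The couplings with finite regularization term. -/
def admissible (μ₀ : Measure (EuclideanSpace ℝ (Fin d₀)))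
    (μ₁ : Measure (EuclideanSpace ℝ (Fin d₁))) (ε : ℝ) :
    Set (Measure (EuclideanSpace ℝ (Fin d₀) × EuclideanSpace ℝ (Fin d₁))) :=
  {π | π ∈ couplings μ₀ μ₁ ∧ ENNReal.ofReal ε * klDiv π (μ₀.prod μ₁) ≠ ⊤}

theorem admissible_zero : admissible μ₀ μ₁ 0 = couplings μ₀ μ₁ := by
  simp [admissible]

theorem ne_top_of_mem_admissible {ε : ℝ} (hε : 0 < ε) (hπ : π ∈ admissible μ₀ μ₁ ε) :
    klDiv π (μ₀.prod μ₁) ≠ ⊤ := fun h => by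
  have := hπ.2
  rw [h, ENNReal.mul_top (by simpa using hε)] at this
  exact this rfl

theorem fixedCost_eq {ε : ℝ} (hε : 0 ≤ ε) : fixedCost μ₀ μ₁ ε π =
    ∫ p, -4 * ‖p.1‖ ^ 2 * ‖p.2‖ ^ 2 ∂π + ε * (klDiv π (μ₀.prod μ₁)).toReal := by
  rw [fixedCost, ENNReal.toReal_mul, ENNReal.toReal_ofReal hε]

variable [IsProbabilityMeasure μ₀]

theorem integrable_of_mem_couplings (hμ₀ : IsCompact μ₀.support) (hμ₁ : IsCompact μ₁.support)
    (hπ : π ∈ couplings μ₀ μ₁)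
    {f : EuclideanSpace ℝ (Fin d₀) × EuclideanSpace ℝ (Fin d₁) → ℝ} (hf : Continuous f) :
    Integrable f π := by
  have := isProbabilityMeasure_of_mem_couplings hπ
  obtain ⟨C, -, hC⟩ := exists_ae_abs_le hμ₀ hμ₁ hf
  exact Integrable.of_bound hf.aestronglyMeasurable C (hC π hπ)

theorem abs_integral_le_of_mem_couplings (hπ : π ∈ couplings μ₀ μ₁)
    {f : EuclideanSpace ℝ (Fin d₀) × EuclideanSpace ℝ (Fin d₁) → ℝ} {C : ℝ}
    (hC : ∀ᵐ p ∂π, |f p| ≤ C) : |∫ p, f p ∂π| ≤ C := by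
  have := isProbabilityMeasure_of_mem_couplings hπ
  simpa using norm_integral_le_of_norm_le_const (f := f) hC

/-- The entry `A ↦ A i j` as a continuous linear functional. -/
noncomputable def entryCLM (i : Fin d₀) (j : Fin d₁) : NormedDual (Matrix (Fin d₀) (Fin d₁) ℝ) :=
  LinearMap.toContinuousLinearMap (Matrix.entryLinearMap ℝ ℝ i j)

@[simp]
theorem entryCLM_apply (i : Fin d₀) (j : Fin d₁) (A : Matrix (Fin d₀) (Fin d₁) ℝ) :
    entryCLM i j A = A i j := rfl

/-- The part `A ↦ -32 ∫ xᵀ A y dπ(x, y)` of the transport cost which is linear in `A`. -/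
noncomputable def corrFunctional
    (π : Measure (EuclideanSpace ℝ (Fin d₀) × EuclideanSpace ℝ (Fin d₁))) :
    NormedDual (Matrix (Fin d₀) (Fin d₁) ℝ) :=
  ∑ i, ∑ j, (-32 * crossCorrelation π i j) • entryCLM i j

theorem corrFunctional_apply (A : Matrix (Fin d₀) (Fin d₁) ℝ) :
    corrFunctional π A = ∑ i, ∑ j, -32 * crossCorrelation π i j * A i j := by
  simp [corrFunctional]

theorem corrFunctional_single (i : Fin d₀) (j : Fin d₁) :
    corrFunctional π (Matrix.single i j 1) = -32 * crossCorrelation π i j := by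
  rw [corrFunctional_apply, Finset.sum_eq_single i, Finset.sum_eq_single j]
  · simp
  · intro b _ hb; simp [hb.symm]
  · simp
  · intro b _ hb; simp [hb.symm]
  · simp

theorem continuous_fixed : Continuous fun p : EuclideanSpace ℝ (Fin d₀) ×
    EuclideanSpace ℝ (Fin d₁) => -4 * ‖p.1‖ ^ 2 * ‖p.2‖ ^ 2 := by fun_prop

theorem continuous_entry_mul (i : Fin d₀) (j : Fin d₁) :
    Continuous fun p : EuclideanSpace ℝ (Fin d₀) × EuclideanSpace ℝ (Fin d₁) => p.1 i * p.2 j := by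
  fun_prop

theorem cost_eq (A : Matrix (Fin d₀) (Fin d₁) ℝ)
    (p : EuclideanSpace ℝ (Fin d₀) × EuclideanSpace ℝ (Fin d₁)) :
    cost A p = -4 * ‖p.1‖ ^ 2 * ‖p.2‖ ^ 2 + ∑ i, ∑ j, (-32 * A i j) * (p.1 i * p.2 j) := by
  rw [cost, sub_eq_add_neg, dotProduct]
  congr 1
  rw [Finset.mul_sum, ← Finset.sum_neg_distrib]
  refine Finset.sum_congr rfl fun i _ => ?_
  rw [Matrix.mulVec, dotProduct, Finset.mul_sum, Finset.mul_sum, ← Finset.sum_neg_distrib]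
  exact Finset.sum_congr rfl fun j _ => by ring

theorem continuous_cost (A : Matrix (Fin d₀) (Fin d₁) ℝ) : Continuous (cost A) := by
  rw [funext (cost_eq A)]
  fun_prop

theorem integral_cost (hμ₀ : IsCompact μ₀.support) (hμ₁ : IsCompact μ₁.support)
    (hπ : π ∈ couplings μ₀ μ₁) (A : Matrix (Fin d₀) (Fin d₁) ℝ) :
    ∫ p, cost A p ∂π = ∫ p, -4 * ‖p.1‖ ^ 2 * ‖p.2‖ ^ 2 ∂π + corrFunctional π A := by
  have hint := fun (i : Fin d₀) (j : Fin d₁) =>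
    (integrable_of_mem_couplings hμ₀ hμ₁ hπ (continuous_entry_mul i j)).const_mul (-32 * A i j)
  simp_rw [cost_eq]
  rw [integral_add (integrable_of_mem_couplings hμ₀ hμ₁ hπ continuous_fixed)
    (integrable_finsetSum _ fun i _ => integrable_finsetSum _ fun j _ => hint i j),
    integral_finsetSum _ fun i _ => integrable_finsetSum _ fun j _ => hint i j,
    corrFunctional_apply]
  congr 1
  refine Finset.sum_congr rfl fun i _ => ?_
  rw [integral_finsetSum _ fun j _ => hint i j]
  refine Finset.sum_congr rfl fun j _ => ?_
  rw [integral_const_mul, crossCorrelation, Matrix.of_apply]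
  ring

theorem exists_norm_corrFunctional_le (hμ₀ : IsCompact μ₀.support) (hμ₁ : IsCompact μ₁.support) :
    ∃ C, ∀ π ∈ couplings μ₀ μ₁, ‖corrFunctional π‖ ≤ C := by
  choose C hC0 hC using fun (i : Fin d₀) (j : Fin d₁) =>
    exists_ae_abs_le hμ₀ hμ₁ (continuous_entry_mul i j)
  refine ⟨∑ i, ∑ j, 32 * C i j * ‖entryCLM (d₀ := d₀) (d₁ := d₁) i j‖, fun π hπ => ?_⟩
  refine norm_sum_le_of_le _ fun i _ => norm_sum_le_of_le _ fun j _ => ?_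
  rw [norm_smul, norm_mul]
  gcongr
  · norm_num
  · exact abs_integral_le_of_mem_couplings hπ (hC i j π hπ)

theorem eotObjective_eq (hμ₀ : IsCompact μ₀.support) (hμ₁ : IsCompact μ₁.support) {ε : ℝ}
    (hπ : π ∈ admissible μ₀ μ₁ ε) (A : Matrix (Fin d₀) (Fin d₁) ℝ) :
    eotObjective μ₀ μ₁ A ε π = ((fixedCost μ₀ μ₁ ε π + corrFunctional π A : ℝ) : EReal) := by
  rw [eotObjective, integral_cost hμ₀ hμ₁ hπ.1, fixedCost, ← EReal.coe_ennreal_toReal hπ.2,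
    ← EReal.coe_add]
  congr 1
  ring

variable [IsProbabilityMeasure μ₁]

theorem prod_mem_admissible (ε : ℝ) : μ₀.prod μ₁ ∈ admissible μ₀ μ₁ ε :=
  ⟨prod_mem_couplings, by simp [klDiv_self]⟩

/-- The product coupling has zero entropy and bounds the infimum above; boundedness of the cost on
the supports bounds it below. So `toReal` in `otValue` loses nothing. -/
theorem coe_otValue (hμ₀ : IsCompact μ₀.support) (hμ₁ : IsCompact μ₁.support)
    (A : Matrix (Fin d₀) (Fin d₁) ℝ) (ε : ℝ) :
    (otValue μ₀ μ₁ A ε : EReal) = ⨅ π ∈ couplings μ₀ μ₁, eotObjective μ₀ μ₁ A ε π := by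
  refine EReal.coe_toReal ?_ ?_
  · refine ne_top_of_le_ne_top ?_ (iInf₂_le (μ₀.prod μ₁) prod_mem_couplings)
    rw [eotObjective_eq hμ₀ hμ₁ (prod_mem_admissible ε)]
    exact EReal.coe_ne_top _
  · obtain ⟨C, -, hC⟩ := exists_ae_abs_le hμ₀ hμ₁ (continuous_cost A)
    refine ne_bot_of_le_ne_bot (EReal.coe_ne_bot (-C)) (le_iInf₂ fun π hπ => ?_)
    rw [eotObjective, ← add_zero ((-C : ℝ) : EReal)]
    refine add_le_add ?_ (EReal.coe_ennreal_nonneg _)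
    exact EReal.coe_le_coe_iff.2 (neg_le_of_abs_le (abs_integral_le_of_mem_couplings hπ (hC π hπ)))

theorem otValue_le (hμ₀ : IsCompact μ₀.support) (hμ₁ : IsCompact μ₁.support) {ε : ℝ}
    (hπ : π ∈ admissible μ₀ μ₁ ε) (A : Matrix (Fin d₀) (Fin d₁) ℝ) :
    otValue μ₀ μ₁ A ε ≤ fixedCost μ₀ μ₁ ε π + corrFunctional π A := by
  rw [← EReal.coe_le_coe_iff, coe_otValue hμ₀ hμ₁, ← eotObjective_eq hμ₀ hμ₁ hπ]
  exact iInf₂_le π hπ.1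

theorem exists_lt_otValue_add (hμ₀ : IsCompact μ₀.support) (hμ₁ : IsCompact μ₁.support) (ε : ℝ)
    (A : Matrix (Fin d₀) (Fin d₁) ℝ) {η : ℝ} (hη : 0 < η) :
    ∃ π ∈ admissible μ₀ μ₁ ε,
      fixedCost μ₀ μ₁ ε π + corrFunctional π A < otValue μ₀ μ₁ A ε + η := by
  have h : (⨅ π ∈ couplings μ₀ μ₁, eotObjective μ₀ μ₁ A ε π)
      < ((otValue μ₀ μ₁ A ε + η : ℝ) : EReal) := by
    rw [← coe_otValue hμ₀ hμ₁, EReal.coe_lt_coe_iff]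
    linarith
  simp only [iInf_lt_iff] at h
  obtain ⟨π, hπ, hlt⟩ := h
  have hadm : π ∈ admissible μ₀ μ₁ ε := by
    refine ⟨hπ, fun htop => ?_⟩
    rw [eotObjective, htop, EReal.coe_ennreal_top, EReal.coe_add_top] at hlt
    exact not_top_lt hlt
  rw [eotObjective_eq hμ₀ hμ₁ hadm, EReal.coe_lt_coe_iff] at hlt
  exact ⟨π, hadm, hlt⟩

/-- The optimal value is Lipschitz in the matrix, uniformly in the regularization parameter. -/
theorem exists_otValue_sub_le (hμ₀ : IsCompact μ₀.support) (hμ₁ : IsCompact μ₁.support) :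
    ∃ C, (∀ π ∈ couplings μ₀ μ₁, ‖corrFunctional π‖ ≤ C) ∧
      ∀ ε A B, otValue μ₀ μ₁ A ε - otValue μ₀ μ₁ B ε ≤ C * ‖A - B‖ := by
  obtain ⟨C, hC⟩ := exists_norm_corrFunctional_le (d₀ := d₀) (d₁ := d₁) hμ₀ hμ₁
  exact ⟨C, hC, fun ε A B => iInf_affine_sub_le (V := fun A => otValue μ₀ μ₁ A ε)
    (fun π hπ B => otValue_le hμ₀ hμ₁ hπ B)
    (fun B η hη => exists_lt_otValue_add hμ₀ hμ₁ ε B hη) (fun π hπ => hC π hπ.1) A B⟩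

/-- For `ε > 0`, near-optimal couplings have close cross-correlations. -/
theorem exists_norm_corrFunctional_sub_le (hμ₀ : IsCompact μ₀.support)
    (hμ₁ : IsCompact μ₁.support) {ε : ℝ} (hε : 0 < ε) (A : Matrix (Fin d₀) (Fin d₁) ℝ) {τ : ℝ}
    (hτ : 0 < τ) :
    ∃ η > 0, ∀ π ∈ admissible μ₀ μ₁ ε, ∀ π' ∈ admissible μ₀ μ₁ ε,
      fixedCost μ₀ μ₁ ε π + corrFunctional π A ≤ otValue μ₀ μ₁ A ε + η →
      fixedCost μ₀ μ₁ ε π' + corrFunctional π' A ≤ otValue μ₀ μ₁ A ε + η →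
      ‖corrFunctional π - corrFunctional π'‖ ≤ τ := by
  choose C hC0 hC using fun (i : Fin d₀) (j : Fin d₁) =>
    exists_ae_abs_le hμ₀ hμ₁ (continuous_entry_mul i j)
  set K := ∑ i, ∑ j, 32 * C i j * ‖entryCLM (d₀ := d₀) (d₁ := d₁) i j‖ with hK
  have hK0 : 0 ≤ K := Finset.sum_nonneg fun i _ => Finset.sum_nonneg fun j _ => by
    have := hC0 i j
    positivity
  -- Chosen so that the final bound `K * (4 / l) = τ * (K / (K + 1))` is at most `τ`.
  set l := 4 * (K + 1) / τ with hl
  have hl0 : 0 < l := by positivity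
  -- With this `η` the entropy gap is at most `2 / l ^ 2`, so both terms of the Pinsker type bound,
  -- `l` times the gap and total mass `2` over `l`, are at most `2 / l`.
  refine ⟨ε / l ^ 2, by positivity, fun π hπ π' hπ' h h' => ?_⟩
  have := isProbabilityMeasure_of_mem_couplings hπ.1
  have := isProbabilityMeasure_of_mem_couplings hπ'.1
  have hfin := ne_top_of_mem_admissible hε hπ
  have hfin' := ne_top_of_mem_admissible hε hπ'
  have hmid := midMeasure_mem_couplings hπ.1 hπ'.1
  have hmidfin := klDiv_midMeasure_ne_top hfin hfin'
  -- The midpoint coupling is a competitor. The transport cost is linear in the coupling and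
  -- cancels, so `ε` times the gap is at most `2 η`.
  have hgap : (klDiv π (μ₀.prod μ₁)).toReal + (klDiv π' (μ₀.prod μ₁)).toReal -
      2 * (klDiv (midMeasure π π') (μ₀.prod μ₁)).toReal ≤ 2 / l ^ 2 := by
    have hle := otValue_le hμ₀ hμ₁ (π := midMeasure π π') (ε := ε)
      ⟨hmid, ENNReal.mul_ne_top ENNReal.ofReal_ne_top hmidfin⟩ A
    rw [fixedCost_eq hε.le] at h h' hle
    have e : ∀ ν ∈ couplings μ₀ μ₁, ∀ t : ℝ, ∫ p, -4 * ‖p.1‖ ^ 2 * ‖p.2‖ ^ 2 ∂ν + t +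
        corrFunctional ν A = ∫ p, cost A p ∂ν + t := fun ν hν t => by
      rw [integral_cost hμ₀ hμ₁ hν]; ring
    rw [e _ hπ.1] at h
    rw [e _ hπ'.1] at h'
    rw [e _ hmid, integral_midMeasure
      (integrable_of_mem_couplings hμ₀ hμ₁ hπ.1 (continuous_cost A))
      (integrable_of_mem_couplings hμ₀ hμ₁ hπ'.1 (continuous_cost A))] at hle
    refine le_of_mul_le_mul_left ?_ hε
    have : ε * (2 / l ^ 2) = 2 * (ε / l ^ 2) := by ring
    rw [this]
    linarith
  have hentry : ∀ i j, |crossCorrelation π i j - crossCorrelation π' i j| ≤ C i j * (4 / l) := by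
    intro i j
    refine (abs_integral_sub_le_klDiv_gap hfin hfin'
      (continuous_entry_mul i j).aestronglyMeasurable (hC i j _ prod_mem_couplings) (hC0 i j)
      hl0).trans (mul_le_mul_of_nonneg_left ?_ (hC0 i j))
    have h1 := mul_le_mul_of_nonneg_left hgap hl0.le
    have h2 : l * (2 / l ^ 2) = 2 / l := by field_simp
    have h3 : (4 : ℝ) / l = 2 / l + 2 / l := by ring
    rw [probReal_univ, probReal_univ, h3]
    norm_num at h1 ⊢
    linarith
  calc ‖corrFunctional π - corrFunctional π'‖
      = ‖∑ i, ∑ j, (-32 * (crossCorrelation π i j - crossCorrelation π' i j)) •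
          entryCLM (d₀ := d₀) (d₁ := d₁) i j‖ := by
        congr 1
        ext B
        simp only [corrFunctional, _root_.sub_apply, _root_.sum_apply, _root_.smul_apply,
          smul_eq_mul, ← Finset.sum_sub_distrib]
        exact Finset.sum_congr rfl fun i _ => Finset.sum_congr rfl fun j _ => by ring
    _ ≤ ∑ i, ∑ j, 32 * C i j * ‖entryCLM (d₀ := d₀) (d₁ := d₁) i j‖ * (4 / l) := by
        refine norm_sum_le_of_le _ fun i _ => norm_sum_le_of_le _ fun j _ => ?_
        rw [norm_smul, norm_mul, Real.norm_eq_abs (_ - _)]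
        have : ‖(-32 : ℝ)‖ = 32 := by norm_num
        rw [this]
        nlinarith [mul_le_mul_of_nonneg_right (hentry i j)
          (norm_nonneg (entryCLM (d₀ := d₀) (d₁ := d₁) i j))]
    _ = K * (4 / l) := by simp only [hK, Finset.sum_mul]
    _ ≤ τ := by
        rw [hl]
        rw [show K * (4 / (4 * (K + 1) / τ)) = τ * (K / (K + 1)) by field_simp]
        exact mul_le_of_le_one_right hτ.le ((div_le_one (by positivity)).2 (by linarith))

theorem exists_hasFDerivAt_otValue (hμ₀ : IsCompact μ₀.support) (hμ₁ : IsCompact μ₁.support)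
    {ε : ℝ} (hε : 0 < ε) (A : Matrix (Fin d₀) (Fin d₁) ℝ) :
    ∃ L : NormedDual (Matrix (Fin d₀) (Fin d₁) ℝ),
      HasFDerivAt (fun A => otValue μ₀ μ₁ A ε) L A ∧
      ∀ τ > 0, ∃ π ∈ admissible μ₀ μ₁ ε,
        fixedCost μ₀ μ₁ ε π + corrFunctional π A < otValue μ₀ μ₁ A ε + τ ∧
          ‖corrFunctional π - L‖ ≤ τ := by
  obtain ⟨C, hC⟩ := exists_norm_corrFunctional_le (d₀ := d₀) (d₁ := d₁) hμ₀ hμ₁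
  exact exists_hasFDerivAt_iInf_affine (V := fun A => otValue μ₀ μ₁ A ε)
    (fun π hπ B => otValue_le hμ₀ hμ₁ hπ B)
    (fun B η hη => exists_lt_otValue_add hμ₀ hμ₁ ε B hη) (fun π hπ => hC π hπ.1) A
    fun τ hτ => exists_norm_corrFunctional_sub_le hμ₀ hμ₁ hε A hτ

end Couplings

/-! ### Block approximation of couplings and finite quantization -/

section Approximation

open InformationTheory ProbabilityTheory

/-- The density is almost everywhere at most `c`, and the continuous function `klFun` is bounded on
`[0, c]`. -/
theorem klDiv_ne_top_of_le_smul {α : Type*} {mα : MeasurableSpace α} {ν ρ : Measure α}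
    [IsFiniteMeasure ν] [IsFiniteMeasure ρ] {c : ENNReal} (hc : c ≠ ⊤) (h : ν ≤ c • ρ) :
    klDiv ν ρ ≠ ⊤ := by
  have hac : ν ≪ ρ := (Measure.absolutelyContinuous_of_le h).trans
    (Measure.smul_absolutelyContinuous)
  have hle : ∀ᵐ x ∂ρ, ν.rnDeriv ρ x ≤ c := by
    refine ae_le_of_forall_setLIntegral_le_of_sigmaFinite (Measure.measurable_rnDeriv _ _)
      fun s hs _ => ?_
    rw [Measure.setLIntegral_rnDeriv hac, setLIntegral_const]
    exact h s
  obtain ⟨C, hC⟩ := (isCompact_Icc (a := (0 : ℝ)) (b := c.toReal)).exists_bound_of_continuousOn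
    continuous_klFun.continuousOn
  refine klDiv_ne_top hac ((integrable_klFun_rnDeriv_iff hac).1 ?_)
  refine Integrable.of_bound (Measurable.aestronglyMeasurable (by fun_prop)) C ?_
  filter_upwards [hle] with x hx
  exact hC _ ⟨ENNReal.toReal_nonneg, ENNReal.toReal_mono hc hx⟩

variable {X Y ι κ : Type*} [MeasurableSpace X] [MeasurableSpace Y] [Fintype ι] [Fintype κ]
  {π : Measure (X × Y)} {q : X → ι} {r : Y → κ}

/-- The measure which gives every block `q⁻¹{i} × r⁻¹{j}` the same mass as `π`, and is proportional
to the product of the marginals of `π` on it. -/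
noncomputable def blockCoupling (π : Measure (X × Y)) (q : X → ι) (r : Y → κ) : Measure (X × Y) :=
  ∑ i, ∑ j, π ((q ⁻¹' {i}) ×ˢ (r ⁻¹' {j})) •
    (π.fst[|q ⁻¹' {i}]).prod (π.snd[|r ⁻¹' {j}])

theorem blockCoupling_prod (s : Set X) (t : Set Y) :
    blockCoupling π q r (s ×ˢ t) = ∑ i, ∑ j, π ((q ⁻¹' {i}) ×ˢ (r ⁻¹' {j})) *
      (π.fst[s|q ⁻¹' {i}] * π.snd[t|r ⁻¹' {j}]) := by
  simp [blockCoupling, Measure.finsetSum_apply, Measure.prod_prod]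

theorem measure_block_eq_zero_left {s : Set X} (hs : MeasurableSet s) (t : Set Y)
    (h : π.fst s = 0) : π (s ×ˢ t) = 0 := by
  rw [Measure.fst_apply hs] at h
  exact measure_mono_null (fun p hp => hp.1) h

theorem measure_block_eq_zero_right (s : Set X) {t : Set Y} (ht : MeasurableSet t)
    (h : π.snd t = 0) : π (s ×ˢ t) = 0 := by
  rw [Measure.snd_apply ht] at h
  exact measure_mono_null (fun p hp => hp.2) h

variable [MeasurableSpace ι] [MeasurableSpace κ] [MeasurableSingletonClass ι]
  [MeasurableSingletonClass κ]

theorem sum_measure_block_right (hr : Measurable r) {s : Set X} (hs : MeasurableSet s) :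
    ∑ j, π (s ×ˢ (r ⁻¹' {j})) = π.fst s := by
  have e : ∀ j, π (s ×ˢ (r ⁻¹' {j})) = (π.restrict (s ×ˢ Set.univ)).map (r ∘ Prod.snd) {j} := by
    intro j
    rw [Measure.map_apply (hr.comp measurable_snd) (measurableSet_singleton j),
      Measure.restrict_apply ((hr.comp measurable_snd) (measurableSet_singleton j))]
    congr 1
    ext p
    simp [and_comm]
  simp_rw [e]
  rw [sum_measure_singleton, Finset.coe_univ, Measure.map_apply (hr.comp measurable_snd) .univ,
    Set.preimage_univ, Measure.restrict_apply_univ, Measure.fst_apply hs, Set.prod_univ]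

theorem sum_measure_block_left (hq : Measurable q) {t : Set Y} (ht : MeasurableSet t) :
    ∑ i, π ((q ⁻¹' {i}) ×ˢ t) = π.snd t := by
  have e : ∀ i, π ((q ⁻¹' {i}) ×ˢ t) = (π.restrict (Set.univ ×ˢ t)).map (q ∘ Prod.fst) {i} := by
    intro i
    rw [Measure.map_apply (hq.comp measurable_fst) (measurableSet_singleton i),
      Measure.restrict_apply ((hq.comp measurable_fst) (measurableSet_singleton i))]
    congr 1
    ext p
    simp
  simp_rw [e]
  rw [sum_measure_singleton, Finset.coe_univ, Measure.map_apply (hq.comp measurable_fst) .univ,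
    Set.preimage_univ, Measure.restrict_apply_univ, Measure.snd_apply ht, Set.univ_prod]

theorem sum_measure_preimage_inter {Z : Type*} [MeasurableSpace Z] {μ : Measure Z} {q : Z → ι}
    (hq : Measurable q) (s : Set Z) : ∑ i, μ (q ⁻¹' {i} ∩ s) = μ s := by
  have e : ∀ i, μ (q ⁻¹' {i} ∩ s) = (μ.restrict s).map q {i} := fun i => by
    rw [Measure.map_apply hq (measurableSet_singleton i),
      Measure.restrict_apply (hq (measurableSet_singleton i))]
  simp_rw [e]
  rw [sum_measure_singleton, Finset.coe_univ, Measure.map_apply hq .univ, Set.preimage_univ,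
    Measure.restrict_apply_univ]

variable [IsProbabilityMeasure π]

theorem fst_blockCoupling (hq : Measurable q) (hr : Measurable r) :
    (blockCoupling π q r).fst = π.fst := by
  ext s hs
  rw [Measure.fst_apply hs, ← Set.prod_univ, blockCoupling_prod,
    ← sum_measure_preimage_inter hq s]
  refine Finset.sum_congr rfl fun i _ => ?_
  have hqi := hq (measurableSet_singleton i)
  calc ∑ j, π ((q ⁻¹' {i}) ×ˢ (r ⁻¹' {j})) * (π.fst[s|q ⁻¹' {i}] * π.snd[Set.univ|r ⁻¹' {j}])
      = ∑ j, π ((q ⁻¹' {i}) ×ˢ (r ⁻¹' {j})) * π.fst[s|q ⁻¹' {i}] := by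
        refine Finset.sum_congr rfl fun j _ => ?_
        -- Conditioning on a null cell gives no probability measure, but then the block has zero
        -- mass and its term vanishes.
        by_cases h : π.snd (r ⁻¹' {j}) = 0
        · rw [measure_block_eq_zero_right _ (hr (measurableSet_singleton j)) h, zero_mul, zero_mul]
        · have := cond_isProbabilityMeasure h
          rw [measure_univ, mul_one]
    _ = π.fst (q ⁻¹' {i} ∩ s) := by
        rw [← Finset.sum_mul, sum_measure_block_right hr hqi, mul_comm,
          cond_mul_eq_inter hqi]

theorem snd_blockCoupling (hq : Measurable q) (hr : Measurable r) :
    (blockCoupling π q r).snd = π.snd := by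
  ext t ht
  rw [Measure.snd_apply ht, ← Set.univ_prod, blockCoupling_prod, Finset.sum_comm,
    ← sum_measure_preimage_inter hr t]
  refine Finset.sum_congr rfl fun j _ => ?_
  have hrj := hr (measurableSet_singleton j)
  calc ∑ i, π ((q ⁻¹' {i}) ×ˢ (r ⁻¹' {j})) * (π.fst[Set.univ|q ⁻¹' {i}] * π.snd[t|r ⁻¹' {j}])
      = ∑ i, π ((q ⁻¹' {i}) ×ˢ (r ⁻¹' {j})) * π.snd[t|r ⁻¹' {j}] := by
        refine Finset.sum_congr rfl fun i _ => ?_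
        by_cases h : π.fst (q ⁻¹' {i}) = 0
        · rw [measure_block_eq_zero_left (hq (measurableSet_singleton i)) _ h, zero_mul, zero_mul]
        · have := cond_isProbabilityMeasure h
          rw [measure_univ, one_mul]
    _ = π.snd (r ⁻¹' {j} ∩ t) := by
        rw [← Finset.sum_mul, sum_measure_block_left hq hrj, mul_comm,
          cond_mul_eq_inter hrj]

theorem blockCoupling_block (hq : Measurable q) (hr : Measurable r) (i : ι) (j : κ) :
    blockCoupling π q r ((q ⁻¹' {i}) ×ˢ (r ⁻¹' {j})) = π ((q ⁻¹' {i}) ×ˢ (r ⁻¹' {j})) := by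
  have hqi := hq (measurableSet_singleton i)
  have hrj := hr (measurableSet_singleton j)
  rw [blockCoupling_prod, Finset.sum_eq_single i, Finset.sum_eq_single j]
  · by_cases h0 : π.fst (q ⁻¹' {i}) = 0
    · rw [measure_block_eq_zero_left hqi _ h0, zero_mul]
    by_cases h1 : π.snd (r ⁻¹' {j}) = 0
    · rw [measure_block_eq_zero_right _ hrj h1, zero_mul]
    rw [cond_apply hqi, cond_apply hrj, Set.inter_self, Set.inter_self,
      ENNReal.inv_mul_cancel h0 (measure_ne_top _ _),
      ENNReal.inv_mul_cancel h1 (measure_ne_top _ _), mul_one, mul_one]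
  · intro l _ hl
    rw [cond_apply (hr (measurableSet_singleton l)), ← Set.preimage_inter,
      Set.singleton_inter_eq_empty.2 (by simpa using hl)]
    simp
  · simp
  · intro k _ hk
    refine Finset.sum_eq_zero fun l _ => ?_
    rw [cond_apply (hq (measurableSet_singleton k)), ← Set.preimage_inter,
      Set.singleton_inter_eq_empty.2 (by simpa using hk)]
    simp
  · simp

/-- There are finitely many blocks, and conditioning on a cell only restricts a marginal and divides
by the mass of the cell; null cells contribute nothing. This domination is what makes the entropy
finite. -/
theorem exists_blockCoupling_le (hq : Measurable q) (hr : Measurable r) :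
    ∃ c : ENNReal, c ≠ ⊤ ∧ blockCoupling π q r ≤ c • π.fst.prod π.snd := by
  have hterm : ∀ i j, ∃ c : ENNReal, c ≠ ⊤ ∧ π ((q ⁻¹' {i}) ×ˢ (r ⁻¹' {j})) •
      (π.fst[|q ⁻¹' {i}]).prod (π.snd[|r ⁻¹' {j}]) ≤ c • π.fst.prod π.snd := by
    intro i j
    by_cases h0 : π.fst (q ⁻¹' {i}) = 0
    · exact ⟨0, by simp, by simp [measure_block_eq_zero_left (hq (measurableSet_singleton i)) _ h0]⟩
    by_cases h1 : π.snd (r ⁻¹' {j}) = 0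
    · exact ⟨0, by simp,
        by simp [measure_block_eq_zero_right _ (hr (measurableSet_singleton j)) h1]⟩
    refine ⟨π ((q ⁻¹' {i}) ×ˢ (r ⁻¹' {j})) * ((π.fst (q ⁻¹' {i}))⁻¹ * (π.snd (r ⁻¹' {j}))⁻¹),
      ENNReal.mul_ne_top (measure_ne_top _ _)
        (ENNReal.mul_ne_top (ENNReal.inv_ne_top.2 h0) (ENNReal.inv_ne_top.2 h1)), ?_⟩
    rw [ProbabilityTheory.cond, ProbabilityTheory.cond, Measure.prod_smul_left, Measure.prod_smul_right, Measure.prod_restrict,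
      smul_smul, smul_smul, ← mul_assoc]
    intro s
    simp only [Measure.smul_apply, smul_eq_mul]
    gcongr
    exact Measure.restrict_le_self
  choose c hc hle using hterm
  refine ⟨∑ i, ∑ j, c i j, by simp [ENNReal.sum_eq_top, hc], fun s => ?_⟩
  simp only [blockCoupling, Measure.finsetSum_apply, Measure.smul_apply, smul_eq_mul,
    Finset.sum_mul]
  exact Finset.sum_le_sum fun i _ => Finset.sum_le_sum fun j _ => hle i j s

/-- Such integrands depend only on the block, and the two measures give every block the same mass.
-/
theorem integral_blockCoupling_comp (hq : Measurable q) (hr : Measurable r) (F : ι × κ → ℝ) :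
    ∫ p, F (q p.1, r p.2) ∂blockCoupling π q r = ∫ p, F (q p.1, r p.2) ∂π := by
  have hm : Measurable fun p : X × Y => (q p.1, r p.2) := by fun_prop
  have hmap : (blockCoupling π q r).map (fun p => (q p.1, r p.2)) =
      π.map fun p => (q p.1, r p.2) := by
    refine Measure.ext_of_singleton fun ⟨i, j⟩ => ?_
    rw [Measure.map_apply hm (measurableSet_singleton _),
      Measure.map_apply hm (measurableSet_singleton _)]
    have e : (fun p : X × Y => (q p.1, r p.2)) ⁻¹' {(i, j)} = (q ⁻¹' {i}) ×ˢ (r ⁻¹' {j}) := by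
      ext p; simp
    rw [e, blockCoupling_block hq hr]
  have hF : Measurable F := measurable_of_countable F
  rw [← integral_map (φ := fun p : X × Y => (q p.1, r p.2)) hm.aemeasurable
      hF.aestronglyMeasurable,
    ← integral_map (φ := fun p : X × Y => (q p.1, r p.2)) hm.aemeasurable
      hF.aestronglyMeasurable, hmap]

/-- A finite measurable quantization which moves the points of a compact set by less than `δ`. -/
theorem exists_quantization {Z : Type*} [MetricSpace Z] [SecondCountableTopology Z] [Nonempty Z]
    [MeasurableSpace Z] [OpensMeasurableSpace Z] {K : Set Z} (hK : IsCompact K) {δ : ℝ}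
    (hδ : 0 < δ) :
    ∃ (n : ℕ) (q : Z → Fin n) (z : Fin n → Z), Measurable q ∧ ∀ x ∈ K, dist x (z (q x)) < δ := by
  obtain ⟨e, he⟩ := TopologicalSpace.exists_dense_seq Z
  obtain ⟨N, hN⟩ : ∃ N : ℕ, ∀ x ∈ K, ∃ k ≤ N, dist x (e k) < δ := by
    obtain ⟨t, ht⟩ := hK.elim_finite_subcover (fun k => Metric.ball (e k) δ)
      (fun k => Metric.isOpen_ball) fun x _ => by
        obtain ⟨k, hk⟩ := he.exists_dist_lt x hδ
        exact Set.mem_iUnion.2 ⟨k, hk⟩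
    refine ⟨t.sup id, fun x hx => ?_⟩
    obtain ⟨k, hk, hxk⟩ := Set.mem_iUnion₂.1 (ht hx)
    exact ⟨k, Finset.le_sup (f := id) hk, hxk⟩
  -- Each point is sent to a nearest one among `e 0, ..., e N`, which on `K` is at least as close as
  -- the center supplied by the finite subcover.
  refine ⟨N + 1, fun x => ⟨SimpleFunc.nearestPtInd e N x,
    Nat.lt_succ_of_le (SimpleFunc.nearestPtInd_le e N x)⟩, fun k => e k, ?_, fun x hx => ?_⟩
  · refine measurable_to_countable' fun k => ?_
    convert! (SimpleFunc.nearestPtInd e N).measurableSet_fiber (k : ℕ) using 1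
    ext x
    simp [Fin.ext_iff]
  · obtain ⟨k, hk, hxk⟩ := hN x hx
    have h := SimpleFunc.edist_nearestPt_le e x hk
    rw [SimpleFunc.nearestPt, SimpleFunc.map_apply, edist_dist, edist_dist,
      ENNReal.ofReal_le_ofReal_iff dist_nonneg] at h
    rw [dist_comm] at hxk ⊢
    exact h.trans_lt hxk

end Approximation

/-! ### Density of finite-entropy couplings and weak compactness -/

section Density

open InformationTheory

variable {d₀ d₁ : ℕ} {μ₀ : Measure (EuclideanSpace ℝ (Fin d₀))}
  {μ₁ : Measure (EuclideanSpace ℝ (Fin d₁))} [IsProbabilityMeasure μ₀]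
  {π : Measure (EuclideanSpace ℝ (Fin d₀) × EuclideanSpace ℝ (Fin d₁))}

/-- Every coupling is approximated by couplings of finite relative entropy. -/
theorem exists_coupling_klDiv_ne_top (hμ₀ : IsCompact μ₀.support) (hμ₁ : IsCompact μ₁.support)
    (hπ : π ∈ couplings μ₀ μ₁)
    {f : EuclideanSpace ℝ (Fin d₀) × EuclideanSpace ℝ (Fin d₁) → ℝ} (hf : Continuous f) {η : ℝ}
    (hη : 0 < η) :
    ∃ π' ∈ couplings μ₀ μ₁, klDiv π' (μ₀.prod μ₁) ≠ ⊤ ∧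
      |∫ p, f p ∂π' - ∫ p, f p ∂π| ≤ η := by
  have := isProbabilityMeasure_of_mem_couplings hπ
  have hu := (hμ₀.prod hμ₁).uniformContinuousAt_of_continuousAt f (fun p _ => hf.continuousAt)
    (Metric.dist_mem_uniformity (half_pos hη))
  obtain ⟨δ, hδ, hfδ⟩ := Metric.mem_uniformity_dist.1 hu
  obtain ⟨n, q, z, hq, hz⟩ := exists_quantization hμ₀ hδ
  obtain ⟨m, r, w, hr, hw⟩ := exists_quantization hμ₁ hδ
  have hπ' : blockCoupling π q r ∈ couplings μ₀ μ₁ :=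
    ⟨(fst_blockCoupling hq hr).trans hπ.1, (snd_blockCoupling hq hr).trans hπ.2⟩
  have := isProbabilityMeasure_of_mem_couplings hπ'
  obtain ⟨c, hc, hle⟩ := exists_blockCoupling_le (π := π) hq hr
  have hkl := klDiv_ne_top_of_le_smul hc hle
  rw [hπ.1, hπ.2] at hkl
  refine ⟨blockCoupling π q r, hπ', hkl, ?_⟩
  -- Quantization moves points of the supports by less than `δ`. This applies to both couplings,
  -- whose quantized integrals agree, so the errors add up to `η`.
  have hclose : ∀ ν ∈ couplings μ₀ μ₁,
      |∫ p, f p ∂ν - ∫ p, f (z (q p.1), w (r p.2)) ∂ν| ≤ η / 2 := by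
    intro ν hν
    have := isProbabilityMeasure_of_mem_couplings hν
    have hs : Integrable (fun p : EuclideanSpace ℝ (Fin d₀) × EuclideanSpace ℝ (Fin d₁) =>
        f (z (q p.1), w (r p.2))) ν := by
      have hF : Measurable fun k : Fin n × Fin m => f (z k.1, w k.2) := measurable_of_countable _
      have hm : Measurable fun p : EuclideanSpace ℝ (Fin d₀) × EuclideanSpace ℝ (Fin d₁) =>
        (q p.1, r p.2) := by fun_prop
      refine Integrable.of_bound (hF.comp hm).aestronglyMeasurable
        (∑ k : Fin n × Fin m, |f (z k.1, w k.2)|) (.of_forall fun p => ?_)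
      exact Finset.single_le_sum (f := fun k : Fin n × Fin m => |f (z k.1, w k.2)|)
        (fun k _ => abs_nonneg _) (Finset.mem_univ (q p.1, r p.2))
    rw [← integral_sub (integrable_of_mem_couplings hμ₀ hμ₁ hν hf) hs]
    refine abs_integral_le_of_mem_couplings hν ?_
    filter_upwards [ae_mem_support_of_mem_couplings hν] with p hp
    have hd : dist p (z (q p.1), w (r p.2)) < δ := max_lt (hz _ hp.1) (hw _ hp.2)
    exact (hfδ hd hp).le
  have h1 := hclose _ hπ'
  have h2 := hclose _ hπ
  rw [integral_blockCoupling_comp hq hr fun k : Fin n × Fin m => f (z k.1, w k.2)] at h1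
  rw [abs_le] at *
  constructor <;> linarith [h1.1, h1.2, h2.1, h2.2]

/-- Along an ultrafilter, couplings of compactly supported measures converge weakly. -/
theorem exists_tendsto_couplings [IsProbabilityMeasure μ₁] (hμ₀ : IsCompact μ₀.support)
    (hμ₁ : IsCompact μ₁.support) {α : Type*} (U : Ultrafilter α)
    {P : α → Measure (EuclideanSpace ℝ (Fin d₀) × EuclideanSpace ℝ (Fin d₁))}
    (hP : ∀ a, P a ∈ couplings μ₀ μ₁) :
    ∃ π ∈ couplings μ₀ μ₁, ∀ f : EuclideanSpace ℝ (Fin d₀) × EuclideanSpace ℝ (Fin d₁) → ℝ,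
      Continuous f → Tendsto (fun a => ∫ p, f p ∂P a) U (𝓝 (∫ p, f p ∂π)) := by
  let S : Set (ProbabilityMeasure (EuclideanSpace ℝ (Fin d₀) × EuclideanSpace ℝ (Fin d₁))) :=
    {Q | Q.toMeasure ∈ couplings μ₀ μ₁}
  have htight : IsTightMeasureSet {ν | ∃ Q, Q ∈ S ∧ Q.toMeasure = ν} := by
    rw [isTightMeasureSet_iff_exists_isCompact_measure_compl_le]
    refine fun ξ _ => ⟨_, hμ₀.prod hμ₁, ?_⟩
    rintro _ ⟨Q, hQ, rfl⟩
    exact (ae_mem_support_of_mem_couplings hQ).le.trans bot_le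
  let Q : α → ProbabilityMeasure (EuclideanSpace ℝ (Fin d₀) × EuclideanSpace ℝ (Fin d₁)) :=
    fun a => ⟨P a, isProbabilityMeasure_of_mem_couplings (hP a)⟩
  obtain ⟨R, -, hR⟩ := (isCompact_closure_of_isTightMeasureSet htight).ultrafilter_le_nhds
    (U.map Q) (le_principal_iff.2 (mem_map.2 (univ_mem' fun a => subset_closure (hP a))))
  have hQR : Tendsto Q U (𝓝 R) := hR
  have hcoup : R.toMeasure ∈ couplings μ₀ μ₁ := by
    constructor
    · have h1 := ((ProbabilityMeasure.continuous_map continuous_fst).tendsto R).comp hQR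
      have h2 : ∀ a, (Q a).map continuous_fst.measurable.aemeasurable =
          (⟨μ₀, inferInstance⟩ : ProbabilityMeasure _) := fun a => Subtype.ext (hP a).1
      have h3 := tendsto_nhds_unique h1 (tendsto_const_nhds.congr fun a => (h2 a).symm)
      exact congrArg Subtype.val h3
    · have h1 := ((ProbabilityMeasure.continuous_map continuous_snd).tendsto R).comp hQR
      have h2 : ∀ a, (Q a).map continuous_snd.measurable.aemeasurable =
          (⟨μ₁, inferInstance⟩ : ProbabilityMeasure _) := fun a => Subtype.ext (hP a).2
      have h3 := tendsto_nhds_unique h1 (tendsto_const_nhds.congr fun a => (h2 a).symm)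
      exact congrArg Subtype.val h3
  refine ⟨R, hcoup, fun f hf => ?_⟩
  obtain ⟨C, hC0, hC⟩ := exists_ae_abs_le hμ₀ hμ₁ hf
  -- Weak convergence tests only bounded functions; truncation at `C` leaves `f` unchanged almost
  -- everywhere for every coupling.
  let g : BoundedContinuousFunction (EuclideanSpace ℝ (Fin d₀) × EuclideanSpace ℝ (Fin d₁)) ℝ :=
    BoundedContinuousFunction.ofNormedAddCommGroup (fun p => max (-C) (min C (f p)))
      (by fun_prop) C fun p => by
        rw [Real.norm_eq_abs, abs_le]
        exact ⟨le_max_left _ _, max_le (by linarith) (min_le_left _ _)⟩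
  have hfg : ∀ ν ∈ couplings μ₀ μ₁, ∫ p, g p ∂ν = ∫ p, f p ∂ν := fun ν hν => by
    refine integral_congr_ae ?_
    filter_upwards [hC ν hν] with p hp
    rw [abs_le] at hp
    change max (-C) (min C (f p)) = f p
    rw [min_eq_right hp.2, max_eq_right hp.1]
  have h := ProbabilityMeasure.tendsto_iff_forall_integral_tendsto.1 hQR g
  rw [hfg _ hcoup] at h
  exact h.congr fun a => hfg _ (hP a)

end Density

/-! ### Limits as the regularization vanishes -/

section Stability

open InformationTheory

variable {d₀ d₁ : ℕ}

theorem frobenius_norm_sq (A : Matrix (Fin d₀) (Fin d₁) ℝ) : ‖A‖ ^ 2 = ∑ i, ∑ j, A i j ^ 2 := by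
  have h0 : 0 ≤ ∑ i, ∑ j, A i j ^ 2 :=
    Finset.sum_nonneg fun i _ => Finset.sum_nonneg fun j _ => sq_nonneg _
  simp only [Matrix.frobenius_norm_def, Real.rpow_two, Real.norm_eq_abs, sq_abs]
  rw [← Real.sqrt_eq_rpow, Real.sq_sqrt h0]

theorem hasFDerivAt_frobenius_norm_sq (A : Matrix (Fin d₀) (Fin d₁) ℝ) :
    HasFDerivAt (fun B : Matrix (Fin d₀) (Fin d₁) ℝ => ‖B‖ ^ 2)
      (∑ i, ∑ j, (2 * A i j) • entryCLM i j : NormedDual (Matrix (Fin d₀) (Fin d₁) ℝ)) A := by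
  simp_rw [frobenius_norm_sq]
  refine HasFDerivAt.fun_sum fun i _ => HasFDerivAt.fun_sum fun j _ => ?_
  simpa using (entryCLM i j).hasFDerivAt.pow 2

variable {μ₀ : Measure (EuclideanSpace ℝ (Fin d₀))}
  {μ₁ : Measure (EuclideanSpace ℝ (Fin d₁))}

/-- Differentiability is essential: `fderiv` defaults to zero elsewhere, and the bound on
`gradMatrix` would then carry no information on couplings. -/
theorem gradMatrix_Phi {ε : ℝ} {A : Matrix (Fin d₀) (Fin d₁) ℝ}
    {L : NormedDual (Matrix (Fin d₀) (Fin d₁) ℝ)}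
    (hL : HasFDerivAt (fun A => otValue μ₀ μ₁ A ε) L A) (i : Fin d₀) (j : Fin d₁) :
    gradMatrix (Phi μ₀ μ₁ ε) A i j = 64 * A i j + L (Matrix.single i j 1) := by
  have h : HasFDerivAt (Phi μ₀ μ₁ ε) _ A :=
    ((hasFDerivAt_frobenius_norm_sq A).const_mul 32).add hL
  have hs : (∑ k, ∑ l, (2 * A k l) • entryCLM k l : NormedDual (Matrix (Fin d₀) (Fin d₁) ℝ))
      (Matrix.single i j 1) = 2 * A i j := by
    simp only [_root_.sum_apply, _root_.smul_apply, entryCLM_apply, smul_eq_mul]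
    rw [Finset.sum_eq_single i, Finset.sum_eq_single j]
    · simp
    · intro b _ hb; simp [hb.symm]
    · simp
    · intro b _ hb; simp [hb.symm]
    · simp
  rw [gradMatrix, Matrix.of_apply, h.fderiv]
  change 32 * (∑ k, ∑ l, (2 * A k l) • entryCLM k l : NormedDual (Matrix (Fin d₀) (Fin d₁) ℝ))
    (Matrix.single i j 1) + L (Matrix.single i j 1) = _
  rw [hs]
  ring

variable [IsProbabilityMeasure μ₀] [IsProbabilityMeasure μ₁]

theorem otValue_zero_le (hμ₀ : IsCompact μ₀.support) (hμ₁ : IsCompact μ₁.support)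
    (ε : ℝ) (A : Matrix (Fin d₀) (Fin d₁) ℝ) : otValue μ₀ μ₁ A 0 ≤ otValue μ₀ μ₁ A ε := by
  rw [← EReal.coe_le_coe_iff, coe_otValue hμ₀ hμ₁, coe_otValue hμ₀ hμ₁]
  refine iInf₂_mono fun π _ => add_le_add le_rfl ?_
  exact EReal.coe_ennreal_le_coe_ennreal_iff.2 (by simp)

theorem otValue_zero_le_integral (hμ₀ : IsCompact μ₀.support) (hμ₁ : IsCompact μ₁.support)
    (A : Matrix (Fin d₀) (Fin d₁) ℝ)
    {π : Measure (EuclideanSpace ℝ (Fin d₀) × EuclideanSpace ℝ (Fin d₁))}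
    (hπ : π ∈ couplings μ₀ μ₁) : otValue μ₀ μ₁ A 0 ≤ ∫ p, cost A p ∂π := by
  have h := otValue_le hμ₀ hμ₁ (ε := 0) (π := π) (by rwa [admissible_zero]) A
  rwa [fixedCost_eq le_rfl, zero_mul, add_zero, ← integral_cost hμ₀ hμ₁ hπ] at h

/-- The entropic optimal value converges to the unregularized one. -/
theorem tendsto_otValue (hμ₀ : IsCompact μ₀.support) (hμ₁ : IsCompact μ₁.support)
    (A : Matrix (Fin d₀) (Fin d₁) ℝ) :
    Tendsto (fun ε => otValue μ₀ μ₁ A ε) (𝓝[>] 0) (𝓝 (otValue μ₀ μ₁ A 0)) := by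
  refine tendsto_order.2 ⟨fun a ha => ?_, fun a ha => ?_⟩
  · refine .of_forall fun ε => ?_
    exact ha.trans_le (otValue_zero_le hμ₀ hμ₁ ε A)
  -- The available room is `2 η`: suboptimality of `π` costs `η`, its finite-entropy replacement `η
  -- / 2`, and the entropy term `η / 2` once `ε` is small.
  · set η := (a - otValue μ₀ μ₁ A 0) / 2 with hη
    have hη0 : 0 < η := by rw [hη]; linarith
    obtain ⟨π, hπ, hlt⟩ := exists_lt_otValue_add hμ₀ hμ₁ 0 A hη0
    obtain ⟨π', hπ', hfin, happ⟩ :=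
      exists_coupling_klDiv_ne_top hμ₀ hμ₁ hπ.1 (continuous_cost A) (η := η / 2) (by positivity)
    rw [fixedCost_eq le_rfl, zero_mul, add_zero, ← integral_cost hμ₀ hμ₁ hπ.1] at hlt
    have hlim : Tendsto (fun ε : ℝ => ε * (klDiv π' (μ₀.prod μ₁)).toReal) (𝓝[>] 0) (𝓝 0) := by
      have := (continuous_mul_const (klDiv π' (μ₀.prod μ₁)).toReal).tendsto (0 : ℝ)
      rw [zero_mul] at this
      exact this.mono_left nhdsWithin_le_nhds
    filter_upwards [self_mem_nhdsWithin, hlim.eventually_lt_const (half_pos hη0)] with ε hε hsmall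
    have hle := otValue_le hμ₀ hμ₁ (ε := ε) (π := π')
      ⟨hπ', ENNReal.mul_ne_top ENNReal.ofReal_ne_top hfin⟩ A
    have hc := integral_cost hμ₀ hμ₁ hπ' A
    rw [fixedCost_eq (le_of_lt hε)] at hle
    linarith [(abs_le.1 happ).2]

theorem tendsto_norm_sub_zero {α : Type*} {F : Filter α} {A : α → Matrix (Fin d₀) (Fin d₁) ℝ}
    {A₀ : Matrix (Fin d₀) (Fin d₁) ℝ} (hA : Tendsto A F (𝓝 A₀)) :
    Tendsto (fun a => ‖A a - A₀‖) F (𝓝 0) :=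
  tendsto_iff_norm_sub_tendsto_zero.1 hA

/-- If `A ε` minimizes `Φ_ε` against `B` along a filter on which `ε ↓ 0` and `A ε → A₀`, then
`Φ_0 A₀ ≤ Φ_0 B`. -/
theorem Phi_zero_le (hμ₀ : IsCompact μ₀.support) (hμ₁ : IsCompact μ₁.support)
    {α : Type*} {F : Filter α} [F.NeBot] {e : α → ℝ} (he : Tendsto e F (𝓝[>] 0))
    {A : α → Matrix (Fin d₀) (Fin d₁) ℝ} {A₀ B : Matrix (Fin d₀) (Fin d₁) ℝ}
    (hA : Tendsto A F (𝓝 A₀)) (hmin : ∀ᶠ a in F, Phi μ₀ μ₁ (e a) (A a) ≤ Phi μ₀ μ₁ (e a) B) :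
    Phi μ₀ μ₁ 0 A₀ ≤ Phi μ₀ μ₁ 0 B := by
  obtain ⟨C, -, hC⟩ := exists_otValue_sub_le (d₀ := d₀) (d₁ := d₁) hμ₀ hμ₁
  have hnorm : Tendsto (fun a => ‖A a‖) F (𝓝 ‖A₀‖) :=
    ((continuous_norm (E := Matrix (Fin d₀) (Fin d₁) ℝ)).tendsto A₀).comp hA
  -- A lower bound for `Φ_ε(A_ε)`: drop the entropy to reach `ε = 0`, then move from `A a` to `A₀`
  -- by the Lipschitz estimate.
  have hleft : Tendsto (fun a => 32 * ‖A a‖ ^ 2 + (otValue μ₀ μ₁ A₀ 0 - C * ‖A a - A₀‖)) F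
      (𝓝 (32 * ‖A₀‖ ^ 2 + (otValue μ₀ μ₁ A₀ 0 - C * 0))) :=
    ((hnorm.pow 2).const_mul 32).add (((tendsto_norm_sub_zero hA).const_mul C).const_sub _)
  have hright : Tendsto (fun a => Phi μ₀ μ₁ (e a) B) F (𝓝 (Phi μ₀ μ₁ 0 B)) :=
    ((tendsto_otValue hμ₀ hμ₁ B).comp he).const_add _
  rw [mul_zero, sub_zero] at hleft
  refine le_of_tendsto_of_tendsto hleft hright ?_
  filter_upwards [hmin] with a ha
  refine le_trans ?_ ha
  have h1 := hC 0 A₀ (A a)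
  have h2 := otValue_zero_le hμ₀ hμ₁ (e a) (A a)
  rw [norm_sub_rev] at h1
  rw [Phi]
  linarith

/-- Near-stationary points of `Φ_ε` cluster at near-stationary points of `Φ_0`. -/
theorem exists_isOTSolution_of_tendsto (hμ₀ : IsCompact μ₀.support) (hμ₁ : IsCompact μ₁.support)
    {δ : ℝ} {A : ℝ → Matrix (Fin d₀) (Fin d₁) ℝ}
    (hstat : ∀ ε : ℝ, 0 < ε → ‖gradMatrix (Phi μ₀ μ₁ ε) (A ε)‖ ≤ δ)
    {A₀ : Matrix (Fin d₀) (Fin d₁) ℝ} {U : Ultrafilter ℝ} (hU : (U : Filter ℝ) ≤ 𝓝[>] 0)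
    (hA : Tendsto A U (𝓝 A₀)) :
    ∃ π, IsOTSolution μ₀ μ₁ A₀ 0 π ∧
      ‖(64 : ℝ) • A₀ - (32 : ℝ) • crossCorrelation π‖ ≤ δ := by
  have hnear : ∀ ε : ℝ, ∃ π ∈ couplings μ₀ μ₁, 0 < ε →
      ∫ p, cost (A ε) p ∂π ≤ otValue μ₀ μ₁ (A ε) ε + ε ∧
      ∀ i j, |gradMatrix (Phi μ₀ μ₁ ε) (A ε) i j - (64 * A ε i j - 32 * crossCorrelation π i j)| ≤
        ε * ‖Matrix.single i j (1 : ℝ)‖ := by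
    intro ε
    by_cases hε : 0 < ε
    swap
    -- A default coupling for `ε ≤ 0`, so that the choice is a total function of `ε`; the
    -- ultrafilter does not see these values.
    · exact ⟨_, prod_mem_couplings, fun h => absurd h hε⟩
    obtain ⟨L, hL, h⟩ := exists_hasFDerivAt_otValue hμ₀ hμ₁ hε (A ε)
    obtain ⟨π, hπ, hlt, hπL⟩ := h ε hε
    refine ⟨π, hπ.1, fun _ => ⟨?_, fun i j => ?_⟩⟩
    · rw [fixedCost_eq hε.le] at hlt
      rw [integral_cost hμ₀ hμ₁ hπ.1]
      have : 0 ≤ ε * (klDiv π (μ₀.prod μ₁)).toReal := by positivity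
      linarith
    · rw [gradMatrix_Phi hL]
      have h1 := (corrFunctional π - L).le_of_opNorm_le hπL (Matrix.single i j (1 : ℝ))
      rw [_root_.sub_apply, corrFunctional_single, Real.norm_eq_abs] at h1
      rw [abs_sub_comm]
      convert! h1 using 2
      ring
  choose P hP hPε using hnear
  obtain ⟨π, hπ, hlim⟩ := exists_tendsto_couplings hμ₀ hμ₁ U hP
  have hpos : ∀ᶠ ε in (U : Filter ℝ), 0 < ε := hU self_mem_nhdsWithin
  have hid : Tendsto (fun ε : ℝ => ε) U (𝓝 0) := tendsto_id.mono_left (hU.trans nhdsWithin_le_nhds)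
  refine ⟨π, ⟨hπ, fun π' hπ' => ?_⟩, ?_⟩
  · have hopt : ∫ p, cost A₀ p ∂π ≤ ∫ p, cost A₀ p ∂π' := by
      refine le_trans ?_ (otValue_zero_le_integral hμ₀ hμ₁ A₀ hπ')
      obtain ⟨C, hCn, hC⟩ := exists_otValue_sub_le (d₀ := d₀) (d₁ := d₁) hμ₀ hμ₁
      -- Passing from `A ε` to `A₀` costs `C ‖A ε - A₀‖` twice: once in the optimal value and once
      -- in the cost of the coupling `P ε`.
      have hright : Tendsto (fun ε => otValue μ₀ μ₁ A₀ ε + 2 * C * ‖A ε - A₀‖ + ε) U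
          (𝓝 (otValue μ₀ μ₁ A₀ 0 + 2 * C * 0 + 0)) :=
        (((tendsto_otValue hμ₀ hμ₁ A₀).mono_left hU).add
          ((tendsto_norm_sub_zero hA).const_mul (2 * C))).add hid
      rw [mul_zero, add_zero, add_zero] at hright
      refine le_of_tendsto_of_tendsto (hlim _ (continuous_cost A₀)) hright ?_
      filter_upwards [hpos] with ε hε
      have h1 := (hPε ε hε).1
      have h2 := hC ε (A ε) A₀
      have h3 := (corrFunctional (P ε)).le_of_opNorm_le (hCn _ (hP ε)) (A ε - A₀)
      rw [Real.norm_eq_abs, map_sub] at h3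
      rw [integral_cost hμ₀ hμ₁ (hP ε)] at h1 ⊢
      linarith [(abs_le.1 h3).1]
    have hadm : ∀ ν ∈ couplings μ₀ μ₁,
        eotObjective μ₀ μ₁ A₀ 0 ν = ((∫ p, cost A₀ p ∂ν : ℝ) : EReal) := fun ν _ => by
      simp [eotObjective]
    rw [hadm π hπ, hadm π' hπ']
    exact EReal.coe_le_coe_iff.2 hopt
  · have hentry : ∀ i j, Tendsto (fun ε => gradMatrix (Phi μ₀ μ₁ ε) (A ε) i j) U
        (𝓝 (((64 : ℝ) • A₀ - (32 : ℝ) • crossCorrelation π) i j)) := by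
      intro i j
      have hAij : Tendsto (fun ε => A ε i j) U (𝓝 (A₀ i j)) :=
        ((entryCLM i j).continuous.tendsto A₀).comp hA
      have hc : Tendsto (fun ε => crossCorrelation (P ε) i j) U (𝓝 (crossCorrelation π i j)) :=
        hlim _ (continuous_entry_mul i j)
      have hmain : Tendsto (fun ε => 64 * A ε i j - 32 * crossCorrelation (P ε) i j) U
          (𝓝 (((64 : ℝ) • A₀ - (32 : ℝ) • crossCorrelation π) i j)) :=
        (hAij.const_mul 64).sub (hc.const_mul 32)
      -- The coupling at parameter `ε` was chosen with slope within `ε` of the derivative, so the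
      -- discrepancy vanishes in the limit.
      have herr : Tendsto (fun ε => gradMatrix (Phi μ₀ μ₁ ε) (A ε) i j -
          (64 * A ε i j - 32 * crossCorrelation (P ε) i j)) U (𝓝 0) := by
        have hb := hid.mul_const ‖(Matrix.single i j (1 : ℝ) : Matrix (Fin d₀) (Fin d₁) ℝ)‖
        rw [zero_mul] at hb
        refine squeeze_zero_norm' ?_ hb
        filter_upwards [hpos] with ε hε
        exact (hPε ε hε).2 i j
      simpa using herr.add hmain
    have hmat : Tendsto (fun ε => gradMatrix (Phi μ₀ μ₁ ε) (A ε)) U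
        (𝓝 ((64 : ℝ) • A₀ - (32 : ℝ) • crossCorrelation π)) :=
      tendsto_pi_nhds.2 fun i => tendsto_pi_nhds.2 fun j => hentry i j
    have hnorm := ((continuous_norm (E := Matrix (Fin d₀) (Fin d₁) ℝ)).tendsto _).comp hmat
    refine le_of_tendsto hnorm ?_
    filter_upwards [hpos] with ε hε
    exact hstat ε hε

end Stability

end EntropicGW

theorem mainTheorem5 (d₀ d₁ : ℕ)
    (μ₀ : Measure (EuclideanSpace ℝ (Fin d₀))) (μ₁ : Measure (EuclideanSpace ℝ (Fin d₁)))
    [IsProbabilityMeasure μ₀] [IsProbabilityMeasure μ₁]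
    (hμ₀ : IsCompact μ₀.support) (hμ₁ : IsCompact μ₁.support)
    (M δ : ℝ) (hδ : 0 ≤ δ)
    (A : ℝ → Matrix (Fin d₀) (Fin d₁) ℝ)
    (hA : ∀ ε : ℝ, 0 < ε → A ε ∈ EntropicGW.matrixBall d₀ d₁ M)
    (hstat : ∀ ε : ℝ, 0 < ε →
      ‖EntropicGW.gradMatrix (EntropicGW.Phi μ₀ μ₁ ε) (A ε)‖ ≤ δ)
    (A₀ : Matrix (Fin d₀) (Fin d₁) ℝ) (hA₀ : MapClusterPt A₀ (𝓝[>] (0 : ℝ)) A) :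
    (∃ π : Measure (EuclideanSpace ℝ (Fin d₀) × EuclideanSpace ℝ (Fin d₁)),
      EntropicGW.IsOTSolution μ₀ μ₁ A₀ 0 π ∧
        ‖(64 : ℝ) • A₀ - (32 : ℝ) • EntropicGW.crossCorrelation π‖ ≤ δ) ∧
    ((∀ᶠ ε in 𝓝[>] (0 : ℝ), ∀ B : Matrix (Fin d₀) (Fin d₁) ℝ,
        EntropicGW.Phi μ₀ μ₁ ε (A ε) ≤ EntropicGW.Phi μ₀ μ₁ ε B) →
      ∀ B : Matrix (Fin d₀) (Fin d₁) ℝ,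
        EntropicGW.Phi μ₀ μ₁ 0 A₀ ≤ EntropicGW.Phi μ₀ μ₁ 0 B) ∧
    (∀ (e : ℕ → ℝ) (r : ℝ), (∀ n, 0 < e n) → Tendsto e atTop (𝓝 0) →
      Tendsto (fun n => A (e n)) atTop (𝓝 A₀) → 0 < r →
      (∀ n, IsMinOn (EntropicGW.Phi μ₀ μ₁ (e n)) (Metric.ball A₀ r) (A (e n))) →
      IsLocalMin (EntropicGW.Phi μ₀ μ₁ 0) A₀) := by
  refine ⟨?_, fun hmin B => ?_, fun e r he he0 hAe hr hmin => ?_⟩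
  -- A cluster point is a limit along an ultrafilter finer than `𝓝[>] 0`, along which the couplings
  -- converge as well.
  · obtain ⟨U, hU, hAU⟩ := mapClusterPt_iff_ultrafilter.1 hA₀
    exact EntropicGW.exists_isOTSolution_of_tendsto hμ₀ hμ₁ hstat hU hAU
  · obtain ⟨U, hU, hAU⟩ := mapClusterPt_iff_ultrafilter.1 hA₀
    refine EntropicGW.Phi_zero_le hμ₀ hμ₁ (F := (U : Filter ℝ)) (e := id) (tendsto_id'.2 hU) hAU ?_
    filter_upwards [hU hmin] with ε hε using hε B
  · filter_upwards [Metric.ball_mem_nhds A₀ hr] with B hB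
    refine EntropicGW.Phi_zero_le hμ₀ hμ₁ (tendsto_nhdsWithin_iff.2 ⟨he0, .of_forall he⟩) hAe
      (.of_forall fun n => hmin n hB)
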